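/- Let $M$ be a smooth $n$-dimensional manifold with tangent bundle $\pi\colon TM\to M$. For a smooth function $h$ on $M$ let $\dot h\colon TM\to\mathbb R$, $\dot h(u)=u\langle h\rangle$, be its scalar lift. Let $U\subset TM\setminus\{0\}$ be a conic sub-bundle, that is, an embedded smooth submanifold of $TM$ (without boundary, of any dimension) that contains no zero vector and satisfies $\pi(U)=M$ and $\lambda u\in U$ for all $u\in U$ and $\lambda\neq0$. Let $\mathcal R$ be the radial vector field on $U$, whose value at $u$ is the velocity at $t=0$ of the curve $t\mapsto e^{t}u$; equivalently, $\mathcal R\langle\pi^*h\rangle=0$ and $\mathcal R\langle\dot h\rangle=\dot h$ for all smooth $h$ on $M$. A Vlasov field on $U$ is a smooth vector field $W$ on $U$ such that, for every smooth function $h$ on $M$, one has $W\langle\pi^*h\rangle=\dot h$ on $U$, and $W\langle\dot h\rangle|_{\lambda u}=\lambda^2\,W\langle\dot h\rangle|_{u}$ for all $u\in U$ and $\lambda>0$. A bivector $\Phi$ on $U$ is simple if $\Phi=X\wedge Y$ with smooth vector fields $X,Y$; it is horizontal if it is simple, $\mathcal R\wedge\Phi=0$, and $\Phi\langle\pi^*f,\dot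 h\rangle=-\dot f\,\dot h$ for all smooth functions $f,h$ on $M$, where $(X\wedge Y)\langle F,G\rangle=X\langle F\rangle Y\langle G\rangle-X\langle G\rangle Y\langle F\rangle$. A Vlasov bivector on $U$ is a horizontal bivector $\Psi$ for which there is a Vlasov field $W$ on $U$ with $\Psi=\mathcal R\wedge W$. Theorem. Let $\Psi$ be a Vlasov bivector on $U$. Then for every $u\in U$ there is a $2$-dimensional embedded smooth submanifold $K\subset U$ with $u\in K$ such that $\Psi$ is tangent to $K$: for every representation $\Psi=X\wedge Y$ with smooth vector fields $X,Y$ on $U$, both $X$ and $Y$ are tangent to $K$, i.e. each of them is induced on $K$ by a smooth vector field on $K$. -/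

import Mathlib

open Set Manifold
open scoped Manifold ContDiff Topology

noncomputable section

namespace Vlasov

/-! ### Scalar fields, vector fields and bivectors on a manifold -/

section General

variable {E : Type*} [NormedAddCommGroup E] [NormedSpace ℝ E]
  {H : Type*} [TopologicalSpace H] (I : ModelWithCorners ℝ E H)
  {N : Type*} [TopologicalSpace N] [ChartedSpace H N]

/-- `h` is a smooth real-valued function on `N`. -/
def IsScalarField (h : N → ℝ) : Prop :=
  ContMDiff I 𝓘(ℝ, ℝ) ∞ h

/-- The section `X` of the tangent bundle of `N` is smooth. -/
def IsVectorField [IsManifold I ∞ N] (X : (p : N) → TangentSpace I p) : Prop :=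
  ContMDiff I I.tangent ∞ (fun p => (⟨p, X p⟩ : TangentBundle I N))

/-- The differential `dF` at `p`, as a linear form on the tangent space at `p`. -/
def differential (F : N → ℝ) (p : N) : Module.Dual ℝ (TangentSpace I p) :=
  (mfderiv I 𝓘(ℝ, ℝ) F p).toLinearMap

/-- The action `X⟨F⟩` of a vector field on a scalar field. -/
def act (X : (p : N) → TangentSpace I p) (F : N → ℝ) (p : N) : ℝ :=
  differential I F p (X p)

/-- The scalar lift `ḣ : TN → ℝ`, `ḣ(u) = u⟨h⟩`. -/
def scalarLift (h : N → ℝ) (u : TangentBundle I N) : ℝ :=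
  differential I h u.proj u.snd

/-- The value at each point of the exterior product `X ∧ Y`. -/
def wedge (X Y : (p : N) → TangentSpace I p) (p : N) : ⋀[ℝ]^2 (TangentSpace I p) :=
  exteriorPower.ιMulti ℝ 2 ![X p, Y p]

/-- `X, Y` are smooth vector fields with `Φ = X ∧ Y`. -/
def IsRepresentation [IsManifold I ∞ N] (Φ : (p : N) → ⋀[ℝ]^2 (TangentSpace I p))
    (X Y : (p : N) → TangentSpace I p) : Prop :=
  IsVectorField I X ∧ IsVectorField I Y ∧ Φ = wedge I X Y

/-- A simple bivector: `Φ = X ∧ Y` for some smooth vector fields. -/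
def IsSimpleBivector [IsManifold I ∞ N] (Φ : (p : N) → ⋀[ℝ]^2 (TangentSpace I p)) : Prop :=
  ∃ X Y : (p : N) → TangentSpace I p, IsRepresentation I Φ X Y

/-- The pairing `Φ⟨F, G⟩` of a bivector with two scalar fields, `(dF ∧ dG)(Φ)`. -/
def pairing (Φ : (p : N) → ⋀[ℝ]^2 (TangentSpace I p)) (F G : N → ℝ) (p : N) : ℝ :=
  exteriorPower.pairingDual ℝ (TangentSpace I p) 2
    (exteriorPower.ιMulti ℝ 2 ![differential I F p, differential I G p]) (Φ p)

theorem pairing_wedge (X Y : (p : N) → TangentSpace I p) (F G : N → ℝ) (p : N) :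
    pairing I (wedge I X Y) F G p =
      act I X F p * act I Y G p - act I X G p * act I Y F p := by
  simp [pairing, wedge, act, exteriorPower.pairingDual_ιMulti_ιMulti, Matrix.det_fin_two]

variable {E' : Type*} [NormedAddCommGroup E'] [NormedSpace ℝ E']
  {H' : Type*} [TopologicalSpace H'] (J : ModelWithCorners ℝ E' H')
  {K : Type*} [TopologicalSpace K] [ChartedSpace H' K] [IsManifold J ∞ K]

/-- The vector field `X` on `N` is tangent to the submanifold `Θ : K → N`: it is induced by a smooth
vector field `Y` on `K`. -/
def IsTangentField (Θ : K → N) (X : (p : N) → TangentSpace I p) : Prop :=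
  ∃ Y : (q : K) → TangentSpace J q, IsVectorField J Y ∧
    ∀ q : K, mfderiv J I Θ q (Y q) = X (Θ q)

/-- The simple bivector `Φ` on `N` is tangent to the submanifold `Θ : K → N`: both factors of every
representation `Φ = X ∧ Y` are tangent to it. -/
def IsTangentBivector [IsManifold I ∞ N] (Θ : K → N)
    (Φ : (p : N) → ⋀[ℝ]^2 (TangentSpace I p)) : Prop :=
  IsSimpleBivector I Φ ∧
    ∀ X Y : (p : N) → TangentSpace I p, IsRepresentation I Φ X Y →
      IsTangentField I J Θ X ∧ IsTangentField I J Θ Y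

end General

/-! ### Conic sub-bundles of the slit tangent bundle -/

section Conic

variable {n : ℕ} {M : Type*} [TopologicalSpace M] [ChartedSpace (EuclideanSpace ℝ (Fin n)) M]

/-- Multiplication by a scalar in the fibres of the tangent bundle. -/
def dilate (c : ℝ) (u : TangentBundle (𝓡 n) M) : TangentBundle (𝓡 n) M :=
  ⟨u.proj, c • u.snd⟩

/-- `U` avoids the zero vectors, is invariant under multiplication by every `c ≠ 0`, and projects
onto `M`. -/
structure IsConic (U : Set (TangentBundle (𝓡 n) M)) : Prop where
  snd_ne_zero : ∀ u ∈ U, u.snd ≠ 0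
  proj_surjective : ∀ p : M, ∃ u ∈ U, u.proj = p
  dilate_mem : ∀ u ∈ U, ∀ c : ℝ, c ≠ 0 → dilate c u ∈ U

variable [IsManifold (𝓡 n) ∞ M]

/-- A conic sub-bundle: a conic subset of the tangent bundle that is an embedded smooth submanifold
without boundary, of some dimension `d` (`d = 2 n` when `U` is open; `d = 2 n - 1` for the light
cone). Local triviality of `U → M` is not required, so that the class is wider than that of the
conic subsets that are smooth fibre bundles. -/
structure IsConicSubbundle {d : ℕ} (U : Set (TangentBundle (𝓡 n) M))
    [ChartedSpace (EuclideanSpace ℝ (Fin d)) U] [IsManifold (𝓡 d) ∞ U] : Prop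
    extends IsConic U where
  isSmoothEmbedding : IsSmoothEmbedding (𝓡 d) (𝓡 n).tangent ∞
    (Subtype.val : U → TangentBundle (𝓡 n) M)

variable {U : Set (TangentBundle (𝓡 n) M)}

/-- Multiplication by `c ≠ 0` as a map of `U` to itself. -/
def IsConic.dilate (hU : IsConic U) (c : ℝ) (hc : c ≠ 0) (u : U) : U :=
  ⟨Vlasov.dilate c u, hU.dilate_mem u u.2 c hc⟩

/-- The function `π^* h` on `U`. -/
def pull (U : Set (TangentBundle (𝓡 n) M)) (h : M → ℝ) (u : U) : ℝ :=
  h (u : TangentBundle (𝓡 n) M).proj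

/-- The restriction to `U` of the scalar lift of `h`. -/
def lift (U : Set (TangentBundle (𝓡 n) M)) (h : M → ℝ) (u : U) : ℝ :=
  scalarLift (𝓡 n) h u

variable {d : ℕ} [ChartedSpace (EuclideanSpace ℝ (Fin d)) U]

/-- The radial vector field on `U`: its value at `u` is the velocity at `t = 0` of the curve
`t ↦ e ^ t u` in `U`. -/
def IsConic.radial (hU : IsConic U) (u : U) : TangentSpace (𝓡 d) u :=
  mfderiv 𝓘(ℝ, ℝ) (𝓡 d) (fun t : ℝ => hU.dilate (Real.exp t) (Real.exp_ne_zero t) u) 0 (1 : ℝ)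

variable [IsManifold (𝓡 d) ∞ U]

/-- A Vlasov field on `U`: a smooth vector field that is horizontal and radially quadratic. -/
structure IsVlasovField (hU : IsConic U) (W : (u : U) → TangentSpace (𝓡 d) u) : Prop where
  isVectorField : IsVectorField (𝓡 d) W
  horizontal : ∀ h : M → ℝ, IsScalarField (𝓡 n) h → ∀ u : U,
    act (𝓡 d) W (pull U h) u = lift U h u
  quadratic : ∀ h : M → ℝ, IsScalarField (𝓡 n) h → ∀ (u : U) (c : ℝ) (hc : 0 < c),
    act (𝓡 d) W (lift U h) (hU.dilate c hc.ne' u) = c ^ 2 * act (𝓡 d) W (lift U h) u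

/-- A horizontal bivector on `U`: a simple bivector with `R ∧ Φ = 0` and
`Φ⟨π^* f, ḣ⟩ = - ḟ ḣ` for all scalar fields `f`, `h` on `M`. -/
structure IsHorizontalBivector (hU : IsConic U)
    (Φ : (u : U) → ⋀[ℝ]^2 (TangentSpace (𝓡 d) u)) : Prop where
  simple : IsSimpleBivector (𝓡 d) Φ
  radial : ∀ u : U, ExteriorAlgebra.ι ℝ (hU.radial u : TangentSpace (𝓡 d) u) *
    (Φ u : ExteriorAlgebra ℝ (TangentSpace (𝓡 d) u)) = 0
  horizontal : ∀ f h : M → ℝ, IsScalarField (𝓡 n) f → IsScalarField (𝓡 n) h → ∀ u : U,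
    pairing (𝓡 d) Φ (pull U f) (lift U h) u = - (lift U f u * lift U h u)

/-- A Vlasov bivector on `U`: a horizontal bivector `Ψ` with `Ψ = R ∧ W` for some Vlasov field
`W`. -/
def IsVlasovBivector (hU : IsConic U)
    (Ψ : (u : U) → ⋀[ℝ]^2 (TangentSpace (𝓡 d) u)) : Prop :=
  IsHorizontalBivector hU Ψ ∧
    ∃ W : (u : U) → TangentSpace (𝓡 d) u, IsVlasovField hU W ∧ Ψ = wedge (𝓡 d) hU.radial W

end Conic

end Vlasov

end

/-! The dilations `δ_s(u) = e^s u` are the flow of the radial field `R`. Horizontality and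
quadraticity of `W` say exactly how dilations act on it: `dδ_s(W_u) = e^{-s} W_{δ_s u}`
(`IsVlasovField.mfderiv_scale`), infinitesimally `[R, W] = W`. The plane field spanned by `R` and
`W` is thus involutive, but Frobenius is not needed: if `γ` is the integral curve of `W` through
`u`, then `F(s, t) = e^s γ(t)` parametrizes the leaf, since `∂_s F = R` and `∂_t F = e^{-s} W`
(`IsVlasovField.mfderiv_sweep`). At each point some `ḣ` equals 1, so `R` and `W` are independent
(`IsVlasovField.exists_dual`). Hence `F` is an immersion at the origin, and `exists_embedded_image`
makes a small piece of its image an embedded surface. If `R ∧ W = X ∧ Y`, then `X` and `Y` lie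
pointwise in the span of `R` and `W` (`eq_add_of_ιMulti_eq`), hence in the image of `dF`; a smooth
local left inverse of `F` gives smooth induced fields. -/

namespace Vlasov

/-! ### Slice charts from the inverse function theorem -/

section Slice

variable {E : Type*} [NormedAddCommGroup E] [NormedSpace ℝ E] [FiniteDimensional ℝ E]
  {EN : Type*} [NormedAddCommGroup EN] [NormedSpace ℝ EN] [FiniteDimensional ℝ EN]

/-- An injective linear map between finite-dimensional spaces is the restriction to the first factor
of an isomorphism `E × C ≃ EN`. -/
theorem exists_equiv_prod_of_injective (f : E →L[ℝ] EN) (hf : Function.Injective f) :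
    ∃ (C : Submodule ℝ EN) (A : (E × C) ≃L[ℝ] EN), ∀ x c, A (x, c) = f x + c := by
  obtain ⟨C, hC⟩ := Submodule.exists_isCompl (LinearMap.range f.toLinearMap)
  let B : (E × C) →ₗ[ℝ] EN := f.toLinearMap.coprod C.subtype
  have hB : Function.Bijective B := by
    constructor
    · rw [← LinearMap.ker_eq_bot, LinearMap.ker_coprod_of_disjoint_range]
      · simp [LinearMap.ker_eq_bot.2 hf]
      · simpa using hC.disjoint
    · rw [← LinearMap.range_eq_top, LinearMap.range_coprod]
      simpa using hC.sup_eq_top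
  refine ⟨C, (LinearEquiv.ofBijective B hB).toContinuousLinearEquiv, fun x c => ?_⟩
  simp [B]

/-- A local homeomorphism given by the inverse function theorem, smooth in both directions on its
whole domain. -/
theorem exists_openPartialHomeomorph_of_contDiffOn {G : EN → EN} {T : Set EN} (hT : IsOpen T)
    (hG : ContDiffOn ℝ ∞ G T) {y₀ : EN} (hy₀ : y₀ ∈ T) (A : EN ≃L[ℝ] EN)
    (hA : HasFDerivAt G (A : EN →L[ℝ] EN) y₀) :
    ∃ e : OpenPartialHomeomorph EN EN, y₀ ∈ e.source ∧ e.source ⊆ T ∧ (∀ y, e y = G y) ∧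
      ContDiffOn ℝ ∞ e e.source ∧ ContDiffOn ℝ ∞ e.symm e.target := by
  have hG₀ : ContDiffAt ℝ ∞ G y₀ := hG.contDiffAt (hT.mem_nhds hy₀)
  let e₀ := hG₀.toOpenPartialHomeomorph G hA (by simp)
  have hcont : ContinuousOn (fderiv ℝ G) T := hG.continuousOn_fderiv_of_isOpen hT (by simp)
  -- Restricting to the open set where the derivative is invertible makes the inverse smooth on the
  -- whole target, not only at the image of `y₀`.
  have hopen : IsOpen (T ∩ fderiv ℝ G ⁻¹' range ((↑) : (EN ≃L[ℝ] EN) → EN →L[ℝ] EN)) :=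
    hcont.isOpen_inter_preimage hT ContinuousLinearEquiv.isOpen
  let e := e₀.restrOpen _ hopen
  have he : ∀ y, e y = G y := fun y => rfl
  have hsub : e.source ⊆ T ∩ fderiv ℝ G ⁻¹' range ((↑) : (EN ≃L[ℝ] EN) → EN →L[ℝ] EN) :=
    fun y hy => hy.2
  refine ⟨e, ⟨hG₀.mem_toOpenPartialHomeomorph_source hA (by simp), hy₀, A, hA.fderiv.symm⟩,
    fun y hy => (hsub hy).1, he, hG.mono fun y hy => (hsub hy).1, fun z hz => ?_⟩
  obtain ⟨hzT, B, hB⟩ := hsub (e.map_target hz)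
  have hGz : ContDiffAt ℝ ∞ G (e.symm z) := hG.contDiffAt (hT.mem_nhds hzT)
  refine (e.contDiffAt_symm (f₀' := B) hz ?_ hGz).contDiffWithinAt
  rw [hB]
  exact (hGz.differentiableAt (by simp)).hasFDerivAt

variable {N : Type*} [TopologicalSpace N] [ChartedSpace EN N] [IsManifold 𝓘(ℝ, EN) ∞ N]

/-- Slice charts for a map with injective differential. -/
theorem exists_sliceChart {F : E → N} {S : Set E} (hS : IsOpen S)
    (hF : ContMDiffOn 𝓘(ℝ, E) 𝓘(ℝ, EN) ∞ F S) {x₀ : E} (hx₀ : x₀ ∈ S)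
    (hinj : Function.Injective (mfderiv 𝓘(ℝ, E) 𝓘(ℝ, EN) F x₀)) :
    ∃ (C : Submodule ℝ EN) (A : (E × C) ≃L[ℝ] EN) (ψ : OpenPartialHomeomorph N EN),
      ψ ∈ IsManifold.maximalAtlas 𝓘(ℝ, EN) ∞ N ∧
      ∀ᶠ x in 𝓝 x₀, F x ∈ ψ.source ∧ ψ (F x) = A (x, 0) := by
  set φ := chartAt EN (F x₀) with hφ
  have hφM : φ ∈ IsManifold.maximalAtlas 𝓘(ℝ, EN) ∞ N := IsManifold.chart_mem_maximalAtlas _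
  have hS' : IsOpen (S ∩ F ⁻¹' φ.source) := hF.continuousOn.isOpen_inter_preimage hS φ.open_source
  set S' := S ∩ F ⁻¹' φ.source
  have hx₀' : x₀ ∈ S' := ⟨hx₀, mem_chart_source _ _⟩
  set f : E → EN := φ ∘ F with hf
  have hfS : ContDiffOn ℝ ∞ f S' := by
    rw [← contMDiffOn_iff_contDiffOn]
    exact (contMDiffOn_of_mem_maximalAtlas hφM).comp (hF.mono inter_subset_left)
      inter_subset_right
  have hfd : DifferentiableAt ℝ f x₀ :=
    (hfS.contDiffAt (hS'.mem_nhds hx₀')).differentiableAt (by simp)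
  have hFd : MDifferentiableAt 𝓘(ℝ, E) 𝓘(ℝ, EN) F x₀ :=
    (hF.contMDiffAt (hS.mem_nhds hx₀)).mdifferentiableAt (by simp)
  have hφd := mdifferentiable_chart (I := 𝓘(ℝ, EN)) (F x₀)
  have hf' : Function.Injective (fderiv ℝ f x₀) := by
    have : mfderiv 𝓘(ℝ, E) 𝓘(ℝ, EN) f x₀ = _ :=
      mfderiv_comp x₀ (hφd.mdifferentiableAt (mem_chart_source _ _)) hFd
    rw [← mfderiv_eq_fderiv, this]
    exact (hφd.mfderiv_injective (mem_chart_source _ _)).comp hinj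
  obtain ⟨C, A, hA⟩ := exists_equiv_prod_of_injective (fderiv ℝ f x₀) hf'
  -- In the coordinates `A` this is `(x, c) ↦ f x + c`; the choice of `A` makes its derivative at `A
  -- (x₀, 0)` the identity.
  let G : EN → EN := fun y => f (A.symm y).1 + ((A.symm y).2 : EN)
  let T : Set EN := (fun y => (A.symm y).1) ⁻¹' S'
  have hT : IsOpen T := hS'.preimage (by fun_prop)
  have hGT : ContDiffOn ℝ ∞ G T := by
    refine ContDiffOn.add (hfS.comp (t := S') (f := fun y => (A.symm y).1) ?_ fun y hy => hy) ?_
    · exact (contDiff_fst.comp A.symm.contDiff).contDiffOn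
    · exact (C.subtypeL.contDiff.comp (contDiff_snd.comp A.symm.contDiff)).contDiffOn
  have hGd : HasFDerivAt G ((ContinuousLinearEquiv.refl ℝ EN : EN ≃L[ℝ] EN) : EN →L[ℝ] EN)
      (A (x₀, 0)) := by
    have h1 : HasFDerivAt (fun y => (A.symm y).1)
        ((ContinuousLinearMap.fst ℝ E C).comp (A.symm : EN →L[ℝ] (E × C))) (A (x₀, 0)) :=
      ((ContinuousLinearMap.fst ℝ E C).comp (A.symm : EN →L[ℝ] (E × C))).hasFDerivAt
    have h2 : HasFDerivAt (fun y => ((A.symm y).2 : EN))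
        (C.subtypeL.comp ((ContinuousLinearMap.snd ℝ E C).comp (A.symm : EN →L[ℝ] (E × C))))
          (A (x₀, 0)) := (C.subtypeL.comp
            ((ContinuousLinearMap.snd ℝ E C).comp (A.symm : EN →L[ℝ] (E × C)))).hasFDerivAt
    have h3 : HasFDerivAt f (fderiv ℝ f x₀) (A.symm (A (x₀, 0))).1 := by
      simpa using hfd.hasFDerivAt
    refine ((HasFDerivAt.comp (f := fun y => (A.symm y).1) _ h3 h1).add h2).congr_fderiv ?_
    ext y
    simpa using (hA (A.symm y).1 (A.symm y).2).symm
  have hy₀ : A (x₀, 0) ∈ T := by simpa [T] using hx₀'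
  obtain ⟨e, hey₀, heT, heG, he, he'⟩ :=
    exists_openPartialHomeomorph_of_contDiffOn hT hGT hy₀ _ hGd
  refine ⟨C, A, φ.trans e.symm, ?_, ?_⟩
  · refine OpenPartialHomeomorph.mem_maximalAtlas_of_contMDiffOn _ ?_ ?_
    · exact he'.contMDiffOn.comp ((contMDiffOn_of_mem_maximalAtlas hφM).mono
        inter_subset_left) (fun y hy => hy.2)
    · refine (contMDiffOn_symm_of_mem_maximalAtlas hφM).comp (he.contMDiffOn.mono ?_) ?_
      · intro y hy
        simpa using hy.1
      · intro y hy
        simpa using hy.2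
  · have h1 : ∀ᶠ x in 𝓝 x₀, A (x, 0) ∈ e.source := by
      have : Continuous fun x : E => A (x, (0 : C)) := by fun_prop
      exact this.continuousAt.eventually (e.open_source.mem_nhds hey₀)
    filter_upwards [h1, hS'.mem_nhds hx₀'] with x hx hxS
    have hex : e (A (x, 0)) = φ (F x) := by simp [heG, G, f]
    refine ⟨⟨hxS.2, ?_⟩, ?_⟩
    · change φ (F x) ∈ e.target
      rw [← hex]
      exact e.map_source hx
    · change e.symm (φ (F x)) = _
      rw [← hex, e.left_inv hx]

end Slice

/-! ### Embedded images and their tangent fields -/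

/-- The chart, defined on the whole image, of the image of an injectively parametrized open set `B`,
with inverse the parametrization `F`. -/
theorem exists_imageChart {E N : Type*} [TopologicalSpace E] [TopologicalSpace N]
    {F : E → N} {B : Set E} (hB : IsOpen B) (hBne : B.Nonempty)
    (hF : ContinuousOn F B) {r : N → E} {V : Set N} (hr : ContinuousOn r V)
    (hFV : MapsTo F B V) (hrF : ∀ x ∈ B, r (F x) = x) :
    ∃ e : OpenPartialHomeomorph (F '' B) E, e.source = univ ∧ e.target = B ∧
      ∀ x ∈ B, (e.symm x : N) = F x := by
  classical
  obtain ⟨b, hb⟩ := hBne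
  -- The value off `B` is arbitrary; it only makes `g` total, which is why `B` must be nonempty.
  let g : E → F '' B := fun x => if h : x ∈ B then ⟨F x, mem_image_of_mem F h⟩
    else ⟨F b, mem_image_of_mem F hb⟩
  have hg : ∀ x ∈ B, (g x : N) = F x := fun x hx => by simp [g, hx]
  have hmem : ∀ q : F '' B, r q ∈ B ∧ F (r q) = q := by
    rintro ⟨_, x, hx, rfl⟩
    simp [hrF x hx, hx]
  let e : OpenPartialHomeomorph (F '' B) E :=
    { toFun := fun q => r q
      invFun := g
      source := univ
      target := B
      map_source' := fun q _ => (hmem q).1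
      map_target' := fun _ _ => mem_univ _
      left_inv' := fun q _ => Subtype.ext (by rw [hg _ (hmem q).1, (hmem q).2])
      right_inv' := fun x hx => by simp only [hg x hx, hrF x hx]
      open_source := isOpen_univ
      open_target := hB
      continuousOn_toFun := (hr.comp_continuous continuous_subtype_val (by
        rintro ⟨_, x, hx, rfl⟩
        exact hFV hx)).continuousOn
      continuousOn_invFun := by
        rw [Topology.IsInducing.subtypeVal.continuousOn_iff]
        exact hF.congr hg }
  exact ⟨e, rfl, rfl, hg⟩

section Embedded

variable {E : Type*} [NormedAddCommGroup E] [NormedSpace ℝ E]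
  {EN : Type*} [NormedAddCommGroup EN] [NormedSpace ℝ EN] [FiniteDimensional ℝ EN]
  {N : Type*} [TopologicalSpace N] [ChartedSpace EN N] [IsManifold 𝓘(ℝ, EN) ∞ N]

/-- Smoothness of a vector field on a manifold all of whose preferred charts coincide. -/
theorem isVectorField_of_singletonChart {K : Type*} [TopologicalSpace K] [ChartedSpace E K]
    [IsManifold 𝓘(ℝ, E) ∞ K] (a : (q : K) → TangentSpace 𝓘(ℝ, E) q)
    (ha : ContMDiff 𝓘(ℝ, E) 𝓘(ℝ, E) ∞ (fun q => (a q : E)))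
    (hK : ∀ p q : K, chartAt E p = chartAt E q) : IsVectorField 𝓘(ℝ, E) a := by
  intro q
  refine (Bundle.contMDiffAt_section (IB := 𝓘(ℝ, E)) (E := TangentSpace 𝓘(ℝ, E)) (s := a) q).2 ?_
  refine ContMDiffAt.congr_of_eventuallyEq ha.contMDiffAt ?_
  refine Filter.Eventually.of_forall fun p => ?_
  change tangentCoordChange 𝓘(ℝ, E) p q p (a p) = a p
  have : tangentCoordChange 𝓘(ℝ, E) p q p = tangentCoordChange 𝓘(ℝ, E) p p p := by
    rw [tangentCoordChange_def, tangentCoordChange_def, extChartAt, extChartAt, hK q p]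
  rw [this]
  exact tangentCoordChange_self (mem_extChartAt_source p)

/-- A map with injective differential at a point parametrizes, near that point, an embedded
submanifold; a smooth vector field is tangent to it as soon as its values belong to the images of the
differentials of the parametrization. -/
theorem exists_embedded_image [FiniteDimensional ℝ E] {F : E → N} {S : Set E} (hS : IsOpen S)
    (hF : ContMDiffOn 𝓘(ℝ, E) 𝓘(ℝ, EN) ∞ F S) {x₀ : E} (hx₀ : x₀ ∈ S)
    (hinj : Function.Injective (mfderiv 𝓘(ℝ, E) 𝓘(ℝ, EN) F x₀)) :
    ∃ K : Set N, F x₀ ∈ K ∧ ∃ (_ : ChartedSpace E K) (_ : IsManifold 𝓘(ℝ, E) ∞ K),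
      IsSmoothEmbedding 𝓘(ℝ, E) 𝓘(ℝ, EN) ∞ (Subtype.val : K → N) ∧
      ∀ X : (p : N) → TangentSpace 𝓘(ℝ, EN) p, IsVectorField 𝓘(ℝ, EN) X →
        (∀ x ∈ S, ∃ w, mfderiv 𝓘(ℝ, E) 𝓘(ℝ, EN) F x w = X (F x)) →
        IsTangentField 𝓘(ℝ, EN) 𝓘(ℝ, E) (Subtype.val : K → N) X := by
  obtain ⟨C, A, ψ, hψ, hev⟩ := exists_sliceChart hS hF hx₀ hinj
  obtain ⟨B, hB, hBo, hxB⟩ := mem_nhds_iff.1 (Filter.inter_mem hev (hS.mem_nhds hx₀))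
  have hψB : ∀ x ∈ B, F x ∈ ψ.source ∧ ψ (F x) = A (x, 0) := fun x hx => (hB hx).1
  have hBS : B ⊆ S := fun x hx => (hB hx).2
  -- A left inverse of `F` smooth on an open set of the ambient manifold: its restriction is the
  -- chart of the image, and its differential extracts tangential components.
  let r : N → E := fun p => (A.symm (ψ p)).1
  have hr : ContMDiffOn 𝓘(ℝ, EN) 𝓘(ℝ, E) ∞ r ψ.source :=
    (contDiff_fst.comp A.symm.contDiff).contMDiff.comp_contMDiffOn
      (contMDiffOn_of_mem_maximalAtlas hψ)
  have hrF : ∀ x ∈ B, r (F x) = x := fun x hx => by simp [r, (hψB x hx).2]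
  obtain ⟨e, hes, het, heF⟩ := exists_imageChart hBo ⟨x₀, hxB⟩ (hF.mono hBS).continuousOn
    hr.continuousOn (fun x hx => (hψB x hx).1) hrF
  let K : Set N := F '' B
  let _ : ChartedSpace E K := e.singletonChartedSpace hes
  have _ : IsManifold 𝓘(ℝ, E) ∞ K := e.isManifold_singleton hes
  have heq : ∀ q : K, e q ∈ B ∧ F (e q) = q := fun q => by
    have hq : e q ∈ B := het.subset (e.map_source (by simp [hes]))
    refine ⟨hq, ?_⟩
    rw [← heF _ hq, e.left_inv (by simp [hes])]
  have hι : IsSmoothEmbedding 𝓘(ℝ, E) 𝓘(ℝ, EN) ∞ (Subtype.val : K → N) := by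
    refine ⟨IsImmersionOfComplement.isImmersion (F := C) fun q => ?_,
      Topology.IsEmbedding.subtypeVal⟩
    refine IsImmersionAtOfComplement.mk_of_charts A e ψ (by simp [hes]) ?_
      (IsManifold.chart_mem_maximalAtlas q) hψ ?_ ?_
    · rw [← (heq q).2]
      exact (hψB _ (heq q).1).1
    · intro p _
      rw [mem_preimage, ← (heq p).2]
      exact (hψB _ (heq p).1).1
    · intro x hx
      have hx' : x ∈ B := by simpa [het] using hx
      simp [heF x hx', (hψB x hx').2]
  refine ⟨K, mem_image_of_mem F hxB, inferInstance, inferInstance, hι, fun X hX hXF => ?_⟩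
  have hιs : ∀ q : K, (q : N) ∈ ψ.source := fun q => by
    rw [← (heq q).2]
    exact (hψB _ (heq q).1).1
  -- Since `r ∘ F = id`, the coefficient of a tangent vector `dF(w)` is `dr(dF(w)) = w`. Defining it
  -- through `r` gives smoothness without choosing `w` smoothly.
  let a : K → E := fun q => mfderiv 𝓘(ℝ, EN) 𝓘(ℝ, E) r q (X q)
  have ha : ContMDiff 𝓘(ℝ, E) 𝓘(ℝ, E) ∞ a := by
    have h1 : ContMDiffOn 𝓘(ℝ, EN).tangent 𝓘(ℝ, E).tangent ∞
        (tangentMapWithin 𝓘(ℝ, EN) 𝓘(ℝ, E) r ψ.source)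
        (Bundle.TotalSpace.proj ⁻¹' ψ.source) :=
      hr.contMDiffOn_tangentMapWithin (by simp) ψ.open_source.uniqueMDiffOn
    have h2 := (contMDiff_snd_tangentBundle_modelSpace E 𝓘(ℝ, E) (n := ∞)).comp_contMDiffOn h1
    have h3 := h2.comp_contMDiff (hX.comp hι.contMDiff) hιs
    refine h3.congr fun q => ?_
    change mfderiv 𝓘(ℝ, EN) 𝓘(ℝ, E) r q (X q) = mfderivWithin 𝓘(ℝ, EN) 𝓘(ℝ, E) r ψ.source q (X q)
    rw [mfderivWithin_of_isOpen ψ.open_source (hιs q)]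
  refine ⟨fun q => (a q : E), ?_, fun q => ?_⟩
  · exact isVectorField_of_singletonChart (fun q => (a q : E)) ha fun p q => rfl
  · have he : MDifferentiableAt 𝓘(ℝ, E) 𝓘(ℝ, E) e q :=
      ((mdifferentiable_chart (I := 𝓘(ℝ, E)) q).mdifferentiableAt (mem_chart_source E q))
    have hFd : MDifferentiableAt 𝓘(ℝ, E) 𝓘(ℝ, EN) F (e q) :=
      (hF.contMDiffAt (hS.mem_nhds (hBS (heq q).1))).mdifferentiableAt (by simp)
    have hrd : MDifferentiableAt 𝓘(ℝ, EN) 𝓘(ℝ, E) r (F (e q)) :=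
      (hr.contMDiffAt (ψ.open_source.mem_nhds (hψB _ (heq q).1).1)).mdifferentiableAt (by simp)
    have h1 : HasMFDerivAt 𝓘(ℝ, E) 𝓘(ℝ, EN) (Subtype.val : K → N) q
        ((mfderiv 𝓘(ℝ, E) 𝓘(ℝ, EN) F (e q)).comp (mfderiv 𝓘(ℝ, E) 𝓘(ℝ, E) e q)) :=
      (hFd.hasMFDerivAt.comp q he.hasMFDerivAt).congr_of_eventuallyEq
        (Filter.Eventually.of_forall fun p => (heq p).2.symm)
    have h2 : mfderiv 𝓘(ℝ, E) 𝓘(ℝ, E) e q (a q : E) = a q := by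
      have := mfderiv_chartAt_eq_tangentCoordChange (I := 𝓘(ℝ, E)) (mem_chart_source E q)
      have h2' : tangentCoordChange 𝓘(ℝ, E) q q q (a q) = a q :=
        tangentCoordChange_self (mem_extChartAt_source q)
      exact (DFunLike.congr_fun this (a q : E)).trans h2'
    obtain ⟨w, hw⟩ := hXF (e q) (hBS (heq q).1)
    have h3 : HasMFDerivAt 𝓘(ℝ, E) 𝓘(ℝ, E) (r ∘ F) (e q) (ContinuousLinearMap.id ℝ E) := by
      refine (hasMFDerivAt_id (e q)).congr_of_eventuallyEq ?_
      filter_upwards [hBo.mem_nhds (heq q).1] with x hx using hrF x hx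
    have h4 := hasMFDerivAt_unique h3 (hrd.hasMFDerivAt.comp (e q) hFd.hasMFDerivAt)
    have h5 : a q = w := by
      have h6 : a q = mfderiv 𝓘(ℝ, EN) 𝓘(ℝ, E) r (F (e q)) (X (F (e q))) := by
        rw [(heq q).2]
      rw [h6, ← hw]
      exact (DFunLike.congr_fun h4 w).symm
    -- The tangent space depends on the point, so `X` is transported along `q = F (e q)` by
    -- generalizing the point.
    have h7 : ∀ p : N, p = F (e q) → (X p : EN) = X (F (e q)) := by
      rintro _ rfl
      rfl
    rw [h1.mfderiv]
    refine Eq.trans ?_ (h7 q (heq q).2.symm).symm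
    change mfderiv 𝓘(ℝ, E) 𝓘(ℝ, EN) F (e q) (mfderiv 𝓘(ℝ, E) 𝓘(ℝ, E) e q (a q : E)) = _
    rw [h2, h5, hw]

end Embedded

/-! ### Linear algebra of simple bivectors -/

/-- If `R ∧ W = X ∧ Y` and `f`, `g` are linear forms dual to `R`, `W`, then `X` and `Y` are
combinations of `R` and `W`. -/
theorem eq_add_of_ιMulti_eq {V : Type*} [AddCommGroup V] [Module ℝ V] {R W X Y : V}
    (h : exteriorPower.ιMulti ℝ 2 ![R, W] = exteriorPower.ιMulti ℝ 2 ![X, Y])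
    (f g : Module.Dual ℝ V) (hfR : f R = 1) (hfW : f W = 0) (hgR : g R = 0) (hgW : g W = 1) :
    X = f X • R + g X • W ∧ Y = f Y • R + g Y • W := by
  -- Pairing with `a ∧ b` turns the hypothesis into an equality of 2 × 2 determinants; the pairs
  -- `(f, g)`, `(k, g)`, `(k, f)` then give Cramer's rule, tested against every form `k`.
  have key : ∀ a b : Module.Dual ℝ V, a R * b W - b R * a W = a X * b Y - b X * a Y := by
    intro a b
    have := congrArg (exteriorPower.pairingDual ℝ V 2 (exteriorPower.ιMulti ℝ 2 ![a, b])) h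
    simp only [exteriorPower.pairingDual_ιMulti_ιMulti, Matrix.det_fin_two, Matrix.of_apply] at this
    simp at this
    linarith
  have h1 := key f g
  rw [hfR, hgW, hgR] at h1
  have h2 : ∀ k : Module.Dual ℝ V, k R = k X * g Y - g X * k Y := fun k => by
    simpa [hgW, hgR] using key k g
  have h3 : ∀ k : Module.Dual ℝ V, -k W = k X * f Y - f X * k Y := fun k => by
    simpa [hfR, hfW] using key k f
  constructor <;> rw [← sub_eq_zero, ← Module.forall_dual_apply_eq_zero_iff ℝ] <;> intro k <;>
    simp only [map_sub, map_add, map_smul, smul_eq_mul]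
  · linear_combination k X * h1 - f X * h2 k + g X * h3 k
  · linear_combination k Y * h1 - f Y * h2 k + g Y * h3 k

/-! ### Smooth integral curves -/

section IntegralCurve

/-- Solutions of an autonomous smooth ODE are smooth. -/
theorem contDiffOn_of_hasDerivAt {E : Type*} [NormedAddCommGroup E] [NormedSpace ℝ E]
    {y : ℝ → E} {w : E → E} {J : Set ℝ} {T : Set E} (hJ : IsOpen J) (hw : ContDiffOn ℝ ∞ w T)
    (hyT : MapsTo y J T) (hy : ∀ t ∈ J, HasDerivAt y (w (y t)) t) : ContDiffOn ℝ ∞ y J := by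
  rw [contDiffOn_infty]
  intro k
  -- Bootstrap: if `y` is `C^k`, so is `y' = w ∘ y`, hence `y` is `C^{k+1}`.
  induction k with
  | zero => exact contDiffOn_zero.2 fun t ht => (hy t ht).continuousAt.continuousWithinAt
  | succ k ih =>
    push_cast
    rw [contDiffOn_succ_iff_deriv_of_isOpen hJ]
    refine ⟨fun t ht => (hy t ht).differentiableAt.differentiableWithinAt, by simp, ?_⟩
    exact ((hw.of_le (mod_cast le_top)).comp ih hyT).congr fun t ht => (hy t ht).deriv

variable {E : Type*} [NormedAddCommGroup E] [NormedSpace ℝ E] [CompleteSpace E]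
  {N : Type*} [TopologicalSpace N] [ChartedSpace E N] [IsManifold 𝓘(ℝ, E) ∞ N]

/-- Through every point there is a smooth integral curve of a smooth vector field. -/
theorem exists_contMDiffOn_integralCurve {X : (p : N) → TangentSpace 𝓘(ℝ, E) p}
    (hX : IsVectorField 𝓘(ℝ, E) X) (p : N) :
    ∃ (γ : ℝ → N) (J : Set ℝ), IsOpen J ∧ 0 ∈ J ∧ γ 0 = p ∧
      ContMDiffOn 𝓘(ℝ, ℝ) 𝓘(ℝ, E) ∞ γ J ∧
      ∀ t ∈ J, HasMFDerivAt 𝓘(ℝ, ℝ) 𝓘(ℝ, E) γ t ((1 : ℝ →L[ℝ] ℝ).smulRight (X (γ t))) := by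
  have : IsManifold 𝓘(ℝ, E) 1 N := IsManifold.of_le (n := ∞) (by simp)
  obtain ⟨γ, hγ0, hγ⟩ := exists_isMIntegralCurveAt_of_contMDiffAt_boundaryless 0
    ((ContMDiff.of_le hX (by simp)).contMDiffAt (x := p))
  have hsrc : ∀ᶠ t in 𝓝 0, γ t ∈ (extChartAt 𝓘(ℝ, E) (γ 0)).source :=
    hγ.continuousAt.preimage_mem_nhds (extChartAt_source_mem_nhds _)
  obtain ⟨J, hJ, hJo, h0⟩ := mem_nhds_iff.1 (hγ.and (hγ.eventually_hasDerivAt.and hsrc))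
  refine ⟨γ, J, hJo, h0, hγ0, ?_, fun t ht => (hJ ht).1⟩
  set φ := extChartAt 𝓘(ℝ, E) (γ 0)
  let v : N → E := fun q => tangentCoordChange 𝓘(ℝ, E) q (γ 0) q (X q)
  have hw : ContDiffOn ℝ ∞ (v ∘ φ.symm) φ.target := by
    have h1 : ContMDiffOn 𝓘(ℝ, E) 𝓘(ℝ, E) ∞ v φ.source := by
      have h2 := (trivializationAt E (TangentSpace 𝓘(ℝ, E)) (γ 0)).contMDiffOn_section_baseSet_iff
        (IB := 𝓘(ℝ, E)) (n := ∞) (s := X)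
      have h3 := h2.1 hX.contMDiffOn
      rw [TangentBundle.trivializationAt_baseSet, ← extChartAt_source 𝓘(ℝ, E)] at h3
      exact h3
    rw [← contMDiffOn_iff_contDiffOn]
    exact h1.comp (contMDiffOn_extChartAt_symm (γ 0)) φ.mapsTo_symm
  have hy : ContDiffOn ℝ ∞ (φ ∘ γ) J := by
    refine contDiffOn_of_hasDerivAt hJo hw (fun t ht => φ.map_source (hJ ht).2.2) fun t ht => ?_
    have h4 : φ.symm (φ (γ t)) = γ t := φ.left_inv (hJ ht).2.2
    simp only [Function.comp_apply, h4]
    exact (hJ ht).2.1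
  refine ((contMDiffOn_extChartAt_symm (γ 0)).comp hy.contMDiffOn
    fun t ht => φ.map_source (hJ ht).2.2).congr fun t ht => ?_
  exact (φ.left_inv (hJ ht).2.2).symm

end IntegralCurve

/-! ### Functions and dilations on the tangent bundle -/

section TangentBundle

variable {n : ℕ} {M : Type*} [TopologicalSpace M] [ChartedSpace (EuclideanSpace ℝ (Fin n)) M]

theorem scalarLift_dilate (h : M → ℝ) (c : ℝ) (u : TangentBundle (𝓡 n) M) :
    scalarLift (𝓡 n) h (dilate c u) = c * scalarLift (𝓡 n) h u :=
  map_smul (differential (𝓡 n) h u.proj) c u.snd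

variable [IsManifold (𝓡 n) ∞ M]

theorem contMDiff_scalarLift {h : M → ℝ} (hh : IsScalarField (𝓡 n) h) :
    ContMDiff (𝓡 n).tangent 𝓘(ℝ, ℝ) ∞ (scalarLift (𝓡 n) h) :=
  (contMDiff_snd_tangentBundle_modelSpace ℝ 𝓘(ℝ, ℝ)).comp
    (hh.contMDiff_tangentMap (m := ∞) (by simp))

theorem contMDiff_comp_proj {h : M → ℝ} (hh : IsScalarField (𝓡 n) h) :
    ContMDiff (𝓡 n).tangent 𝓘(ℝ, ℝ) ∞ (fun u : TangentBundle (𝓡 n) M => h u.proj) :=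
  ContMDiff.comp hh (Bundle.contMDiff_proj (TangentSpace (𝓡 n)))

/-- Linear functions of the coordinates at `p` extend, as germs at `p`, to scalar fields. -/
theorem exists_isScalarField_eventuallyEq [T2Space M] (p : M)
    (l : EuclideanSpace ℝ (Fin n) →L[ℝ] ℝ) :
    ∃ h : M → ℝ, IsScalarField (𝓡 n) h ∧ h =ᶠ[𝓝 p] fun q => l (extChartAt (𝓡 n) p q) := by
  obtain ⟨χ⟩ : Nonempty (SmoothBumpFunction (𝓡 n) p) := inferInstance
  refine ⟨fun q => χ q • l (extChartAt (𝓡 n) p q), χ.contMDiff_smul ?_, ?_⟩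
  · exact l.contDiff.contMDiff.comp_contMDiffOn contMDiffOn_extChartAt
  · filter_upwards [χ.eventuallyEq_one] with q hq
    simp [hq]

/-- The fibre coordinate of `v` is the differential of the base chart applied to `v`. The identity
is needed near `u`, not only at `u`, because it will be differentiated. -/
theorem scalarLift_eventuallyEq {h : M → ℝ} {l : EuclideanSpace ℝ (Fin n) →L[ℝ] ℝ}
    (u : TangentBundle (𝓡 n) M)
    (hh : h =ᶠ[𝓝 u.proj] fun q => l (extChartAt (𝓡 n) u.proj q)) :
    scalarLift (𝓡 n) h =ᶠ[𝓝 u] fun v => l (extChartAt (𝓡 n).tangent u v).2 := by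
  have hc : Filter.Tendsto (Bundle.TotalSpace.proj : TangentBundle (𝓡 n) M → M) (𝓝 u)
      (𝓝 u.proj) := (FiberBundle.continuous_proj _ _).continuousAt
  have hs : ∀ᶠ q in 𝓝 u.proj, q ∈ (chartAt (EuclideanSpace ℝ (Fin n)) u.proj).source :=
    chart_source_mem_nhds _ _
  filter_upwards [hc.eventually hh.eventuallyEq_nhds, hc.eventually hs] with v hv hvs
  have h1 : HasMFDerivAt (𝓡 n) 𝓘(ℝ, ℝ) (fun q => l (extChartAt (𝓡 n) u.proj q)) v.proj
      (l.comp (tangentCoordChange (𝓡 n) v.proj u.proj v.proj)) := by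
    have h2 := hasMFDerivAt_extChartAt (I := 𝓡 n) hvs
    rw [mfderiv_chartAt_eq_tangentCoordChange hvs] at h2
    exact l.hasFDerivAt.hasMFDerivAt.comp v.proj h2
  have h3 := hv.mfderiv_eq (I := 𝓡 n) (I' := 𝓘(ℝ, ℝ))
  rw [h1.mfderiv] at h3
  exact DFunLike.congr_fun h3 v.snd

theorem comp_proj_eventuallyEq {h : M → ℝ} {l : EuclideanSpace ℝ (Fin n) →L[ℝ] ℝ}
    (u : TangentBundle (𝓡 n) M)
    (hh : h =ᶠ[𝓝 u.proj] fun q => l (extChartAt (𝓡 n) u.proj q)) :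
    (fun v : TangentBundle (𝓡 n) M => h v.proj) =ᶠ[𝓝 u]
      fun v => l (extChartAt (𝓡 n).tangent u v).1 := by
  have hc : Filter.Tendsto (Bundle.TotalSpace.proj : TangentBundle (𝓡 n) M → M) (𝓝 u)
      (𝓝 u.proj) := (FiberBundle.continuous_proj _ _).continuousAt
  filter_upwards [hc.eventually hh] with v hv
  exact hv

/-- A nonzero tangent vector is detected by some scalar field. -/
theorem exists_scalarLift_eq_one [T2Space M] (u : TangentBundle (𝓡 n) M) (hu : u.snd ≠ 0) :
    ∃ h : M → ℝ, IsScalarField (𝓡 n) h ∧ scalarLift (𝓡 n) h u = 1 := by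
  have hsep : ∀ x : EuclideanSpace ℝ (Fin n), x ≠ 0 →
      ∃ l : EuclideanSpace ℝ (Fin n) →L[ℝ] ℝ, l x = 1 :=
    fun x hx => SeparatingDual.exists_eq_one hx
  obtain ⟨l, hl⟩ := hsep u.snd hu
  obtain ⟨h, hh, hhl⟩ := exists_isScalarField_eventuallyEq u.proj l
  refine ⟨h, hh, ?_⟩
  rw [(scalarLift_eventuallyEq u hhl).eq_of_nhds]
  have : (extChartAt (𝓡 n).tangent u u).2 = u.snd :=
    tangentCoordChange_self (mem_extChartAt_source u.proj)
  rw [this]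
  exact hl

/-- The functions `h ∘ π` and `ḣ` separate the tangent vectors of the tangent bundle. -/
theorem eq_of_mfderiv_eq [T2Space M] {u : TangentBundle (𝓡 n) M}
    (a b : TangentSpace (𝓡 n).tangent u)
    (h₁ : ∀ h : M → ℝ, IsScalarField (𝓡 n) h →
      mfderiv (𝓡 n).tangent 𝓘(ℝ, ℝ) (fun v : TangentBundle (𝓡 n) M => h v.proj) u a =
        mfderiv (𝓡 n).tangent 𝓘(ℝ, ℝ) (fun v : TangentBundle (𝓡 n) M => h v.proj) u b)
    (h₂ : ∀ h : M → ℝ, IsScalarField (𝓡 n) h →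
      mfderiv (𝓡 n).tangent 𝓘(ℝ, ℝ) (scalarLift (𝓡 n) h) u a =
        mfderiv (𝓡 n).tangent 𝓘(ℝ, ℝ) (scalarLift (𝓡 n) h) u b) : a = b := by
  have : IsManifold (𝓡 n).tangent 1 (TangentBundle (𝓡 n) M) := IsManifold.of_le (n := ∞) (by simp)
  -- At its own base point the chart has identity differential, so the linear functions of the chart
  -- below read off the two components of a tangent vector.
  have hφ : HasMFDerivAt (𝓡 n).tangent
      𝓘(ℝ, EuclideanSpace ℝ (Fin n) × EuclideanSpace ℝ (Fin n))
      (extChartAt (𝓡 n).tangent u) u (ContinuousLinearMap.id ℝ _) := by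
    rw [← mfderiv_extChartAt_self]
    exact (mdifferentiableAt_extChartAt (mem_chart_source _ u)).hasMFDerivAt
  have key : ∀ (g : TangentBundle (𝓡 n) M → ℝ)
      (L : (EuclideanSpace ℝ (Fin n) × EuclideanSpace ℝ (Fin n)) →L[ℝ] ℝ),
      g =ᶠ[𝓝 u] (fun v => L (extChartAt (𝓡 n).tangent u v)) →
      mfderiv (𝓡 n).tangent 𝓘(ℝ, ℝ) g u = L := fun g L hg =>
    ((L.hasFDerivAt.hasMFDerivAt.comp u hφ).congr_of_eventuallyEq hg).mfderiv
  refine Prod.ext ?_ ?_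
  · refine (SeparatingDual.eq_iff_forall_dual_eq (R := ℝ)).2 fun l => ?_
    obtain ⟨h, hh, hhl⟩ := exists_isScalarField_eventuallyEq u.proj l
    have h3 := key _ (l.comp (ContinuousLinearMap.fst ℝ _ _)) (comp_proj_eventuallyEq u hhl)
    exact ((DFunLike.congr_fun h3 a).symm.trans (h₁ h hh)).trans (DFunLike.congr_fun h3 b)
  · refine (SeparatingDual.eq_iff_forall_dual_eq (R := ℝ)).2 fun l => ?_
    obtain ⟨h, hh, hhl⟩ := exists_isScalarField_eventuallyEq u.proj l
    have h3 := key _ (l.comp (ContinuousLinearMap.snd ℝ _ _)) (scalarLift_eventuallyEq u hhl)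
    exact ((DFunLike.congr_fun h3 a).symm.trans (h₂ h hh)).trans (DFunLike.congr_fun h3 b)

/-- Coordinate changes are linear on fibres, so in a bundle chart the map is scalar multiplication
of the fibre coordinate. -/
theorem contMDiff_dilate : ContMDiff (𝓘(ℝ, ℝ).prod (𝓡 n).tangent) (𝓡 n).tangent ∞
    (fun x : ℝ × TangentBundle (𝓡 n) M => dilate x.1 x.2) := by
  intro x
  rw [Bundle.contMDiffAt_totalSpace]
  have hproj : ContMDiffAt (𝓘(ℝ, ℝ).prod (𝓡 n).tangent) (𝓡 n) ∞
      (fun y : ℝ × TangentBundle (𝓡 n) M => y.2.proj) x :=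
    (Bundle.contMDiff_proj (TangentSpace (𝓡 n))).contMDiffAt.comp x contMDiffAt_snd
  refine ⟨hproj, ?_⟩
  have h1 := (Bundle.contMDiffAt_totalSpace.1 (contMDiffAt_snd (I := 𝓘(ℝ, ℝ))
    (J := (𝓡 n).tangent) (M := ℝ) (N := TangentBundle (𝓡 n) M) (p := x) (n := ∞))).2
  have h2 := (contMDiffAt_fst (I := 𝓘(ℝ, ℝ)) (J := (𝓡 n).tangent) (M := ℝ)
    (N := TangentBundle (𝓡 n) M) (p := x) (n := ∞)).smul h1
  refine h2.congr_of_eventuallyEq ?_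
  refine Filter.Eventually.of_forall fun y => ?_
  exact map_smul (tangentCoordChange (𝓡 n) y.2.proj x.2.proj y.2.proj) y.1 y.2.snd

end TangentBundle

/-! ### Differentials of immersions -/

section Immersion

variable {E : Type*} [NormedAddCommGroup E] [NormedSpace ℝ E]
  {N : Type*} [TopologicalSpace N] [ChartedSpace E N]
  {EP : Type*} [NormedAddCommGroup EP] [NormedSpace ℝ EP]
  {HP : Type*} [TopologicalSpace HP] {J : ModelWithCorners ℝ EP HP}
  {P : Type*} [TopologicalSpace P] [ChartedSpace HP P]

/-- In adapted charts `f` is `x ↦ (x, 0)`. Projecting to the first factor gives `φ = (L ∘ ψ) ∘ f`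
near `x`, and `φ` has injective differential. -/
theorem injective_mfderiv_of_isImmersionAt {f : N → P} {x : N}
    (hf : IsImmersionAt 𝓘(ℝ, E) J ∞ f x) : Function.Injective (mfderiv 𝓘(ℝ, E) J f x) := by
  set φ := hf.domChart
  set ψ := hf.codChart
  let L : EP →L[ℝ] E := (ContinuousLinearMap.fst ℝ E hf.complement).comp
    (hf.equiv.symm : EP →L[ℝ] (E × hf.complement))
  have hψ : MDifferentiableAt J 𝓘(ℝ, EP) (ψ.extend J) (f x) :=
    ((ψ.contMDiffOn_extend hf.codChart_mem_maximalAtlas).contMDiffAt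
      (ψ.open_source.mem_nhds hf.mem_codChart_source)).mdifferentiableAt (by simp)
  have hg : MDifferentiableAt J 𝓘(ℝ, E) (L ∘ ψ.extend J) (f x) :=
    L.differentiableAt.mdifferentiableAt.comp (f x) hψ
  have hfd : MDifferentiableAt 𝓘(ℝ, E) J f x := hf.contMDiffAt.mdifferentiableAt (by simp)
  have hφ : φ.MDifferentiable 𝓘(ℝ, E) 𝓘(ℝ, E) :=
    ⟨fun y hy => ((contMDiffOn_of_mem_maximalAtlas hf.domChart_mem_maximalAtlas) y
      hy).mdifferentiableWithinAt (by simp),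
     fun y hy => ((contMDiffOn_symm_of_mem_maximalAtlas hf.domChart_mem_maximalAtlas) y
      hy).mdifferentiableWithinAt (by simp)⟩
  have heq : φ =ᶠ[𝓝 x] (L ∘ ψ.extend J) ∘ f := by
    filter_upwards [φ.open_source.mem_nhds hf.mem_domChart_source] with y hy
    have h1 := hf.writtenInCharts
      ((φ.extend 𝓘(ℝ, E)).map_source (by rwa [φ.extend_source]))
    have h2 : (φ.extend 𝓘(ℝ, E)).symm (φ.extend 𝓘(ℝ, E) y) = y := φ.extend_left_inv hy
    rw [Function.comp_apply, Function.comp_apply, h2] at h1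
    change φ y = L (ψ.extend J (f y))
    rw [h1]
    simp [L, φ]
  have h3 : mfderiv 𝓘(ℝ, E) 𝓘(ℝ, E) φ x = (mfderiv J 𝓘(ℝ, E) (L ∘ ψ.extend J) (f x)).comp
      (mfderiv 𝓘(ℝ, E) J f x) :=
    ((hg.hasMFDerivAt.comp x hfd.hasMFDerivAt).congr_of_eventuallyEq heq).mfderiv
  have h4 := hφ.mfderiv_injective hf.mem_domChart_source
  rw [h3] at h4
  exact Function.Injective.of_comp h4

end Immersion

/-! ### Dilations and test functions on the conic sub-bundle -/

section Conic

variable {n : ℕ} {M : Type*} [TopologicalSpace M] [ChartedSpace (EuclideanSpace ℝ (Fin n)) M]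
  {U : Set (TangentBundle (𝓡 n) M)}

/-- The flow `(t, u) ↦ e ^ t u` of the radial field. -/
noncomputable def IsConic.scale (hU : IsConic U) (t : ℝ) (u : U) : U :=
  hU.dilate (Real.exp t) (Real.exp_ne_zero t) u

theorem IsConic.scale_add (hU : IsConic U) (s t : ℝ) (u : U) :
    hU.scale (s + t) u = hU.scale s (hU.scale t u) := by
  refine Subtype.ext ?_
  change (⟨_, _⟩ : TangentBundle (𝓡 n) M) = ⟨_, _⟩
  congr 1
  rw [Real.exp_add]
  exact mul_smul (Real.exp s) (Real.exp t) (u : TangentBundle (𝓡 n) M).snd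

theorem IsConic.scale_zero (hU : IsConic U) (u : U) : hU.scale 0 u = u := by
  refine Subtype.ext ?_
  change (⟨_, _⟩ : TangentBundle (𝓡 n) M) = ⟨_, _⟩
  congr 1
  rw [Real.exp_zero, one_smul]

theorem lift_scale (hU : IsConic U) (h : M → ℝ) (t : ℝ) (u : U) :
    lift U h (hU.scale t u) = Real.exp t * lift U h u :=
  scalarLift_dilate h _ _

variable [IsManifold (𝓡 n) ∞ M] {d : ℕ}
  [ChartedSpace (EuclideanSpace ℝ (Fin d)) U] [IsManifold (𝓡 d) ∞ U]

theorem IsConicSubbundle.contMDiff_pull (hU : IsConicSubbundle (d := d) U) {h : M → ℝ}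
    (hh : IsScalarField (𝓡 n) h) : ContMDiff (𝓡 d) 𝓘(ℝ, ℝ) ∞ (pull U h) :=
  (contMDiff_comp_proj hh).comp hU.isSmoothEmbedding.contMDiff

theorem IsConicSubbundle.contMDiff_lift (hU : IsConicSubbundle (d := d) U) {h : M → ℝ}
    (hh : IsScalarField (𝓡 n) h) : ContMDiff (𝓡 d) 𝓘(ℝ, ℝ) ∞ (lift U h) :=
  (contMDiff_scalarLift hh).comp hU.isSmoothEmbedding.contMDiff

/-- Dilation is smooth into the tangent bundle; the inclusion of `U` is an embedding and an
immersion, so continuity and smoothness descend to `U`. -/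
theorem IsConicSubbundle.contMDiff_scale (hU : IsConicSubbundle (d := d) U) :
    ContMDiff (𝓘(ℝ, ℝ).prod (𝓡 d)) (𝓡 d) ∞ (fun x : ℝ × U => hU.scale x.1 x.2) := by
  have h1 : ContMDiff (𝓘(ℝ, ℝ).prod (𝓡 d)) (𝓡 n).tangent ∞
      (Subtype.val ∘ fun x : ℝ × U => hU.scale x.1 x.2) :=
    contMDiff_dilate.comp ((Real.contDiff_exp.contMDiff.comp contMDiff_fst).prodMk
      (hU.isSmoothEmbedding.contMDiff.comp contMDiff_snd))
  rw [ContMDiff.iff_comp_isImmersion hU.isSmoothEmbedding.isImmersion]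
  exact ⟨hU.isSmoothEmbedding.isEmbedding.continuous_iff.2 h1.continuous, h1⟩

/-- The functions `π^* h` and `ḣ` separate the tangent vectors of `U`. -/
theorem IsConicSubbundle.eq_of_differential_eq [T2Space M] (hU : IsConicSubbundle (d := d) U)
    {u : U} (a b : TangentSpace (𝓡 d) u)
    (h₁ : ∀ h : M → ℝ, IsScalarField (𝓡 n) h →
      differential (𝓡 d) (pull U h) u a = differential (𝓡 d) (pull U h) u b)
    (h₂ : ∀ h : M → ℝ, IsScalarField (𝓡 n) h →
      differential (𝓡 d) (lift U h) u a = differential (𝓡 d) (lift U h) u b) : a = b := by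
  have hv : MDifferentiableAt (𝓡 d) (𝓡 n).tangent (Subtype.val : U → TangentBundle (𝓡 n) M) u :=
    hU.isSmoothEmbedding.contMDiff.contMDiffAt.mdifferentiableAt (by simp)
  refine injective_mfderiv_of_isImmersionAt (hU.isSmoothEmbedding.isImmersion.isImmersionAt u) ?_
  refine eq_of_mfderiv_eq _ _ (fun h hh => ?_) fun h hh => ?_
  · have h3 := ((contMDiff_comp_proj hh).contMDiffAt.mdifferentiableAt
      (by simp)).hasMFDerivAt.comp u hv.hasMFDerivAt
    have h4 := h₁ h hh
    have h5 : mfderiv (𝓡 d) 𝓘(ℝ, ℝ) (pull U h) u = _ := h3.mfderiv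
    exact ((DFunLike.congr_fun h5 a).symm.trans h4).trans (DFunLike.congr_fun h5 b)
  · have h3 := ((contMDiff_scalarLift hh).contMDiffAt.mdifferentiableAt
      (by simp)).hasMFDerivAt.comp u hv.hasMFDerivAt
    have h4 := h₂ h hh
    have h5 : mfderiv (𝓡 d) 𝓘(ℝ, ℝ) (lift U h) u = _ := h3.mfderiv
    exact ((DFunLike.congr_fun h5 a).symm.trans h4).trans (DFunLike.congr_fun h5 b)

end Conic

/-! ### The radial field and the scaling of a Vlasov field -/

section VlasovField

variable {n : ℕ} {M : Type*} [TopologicalSpace M] [ChartedSpace (EuclideanSpace ℝ (Fin n)) M]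
  [IsManifold (𝓡 n) ∞ M] {U : Set (TangentBundle (𝓡 n) M)} {d : ℕ}
  [ChartedSpace (EuclideanSpace ℝ (Fin d)) U] [IsManifold (𝓡 d) ∞ U]

/-- Smoothness of the curve ensures that the `mfderiv` defining the radial field is a true velocity
and not the default value 0. -/
theorem IsConicSubbundle.hasMFDerivAt_scale_zero (hU : IsConicSubbundle (d := d) U) (u : U) :
    HasMFDerivAt 𝓘(ℝ, ℝ) (𝓡 d) (fun t : ℝ => hU.scale t u) 0
      ((1 : ℝ →L[ℝ] ℝ).smulRight (hU.radial (d := d) u)) := by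
  have h1 : ContMDiff 𝓘(ℝ, ℝ) (𝓡 d) ∞ (fun t : ℝ => hU.scale t u) :=
    hU.contMDiff_scale.comp (contMDiff_id.prodMk contMDiff_const)
  have h2 := (h1.contMDiffAt.mdifferentiableAt (x := (0 : ℝ)) (by simp)).hasMFDerivAt
  have h3 : mfderiv 𝓘(ℝ, ℝ) (𝓡 d) (fun t : ℝ => hU.scale t u) 0 =
      (1 : ℝ →L[ℝ] ℝ).smulRight (hU.radial (d := d) u) := by
    refine ContinuousLinearMap.ext_ring ?_
    exact (one_smul ℝ (hU.radial (d := d) u)).symm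
  rwa [h3] at h2

/-- The curves `t ↦ e ^ t u` are integral curves of the radial field. -/
theorem IsConicSubbundle.hasMFDerivAt_scale (hU : IsConicSubbundle (d := d) U) (u : U) (s : ℝ) :
    HasMFDerivAt 𝓘(ℝ, ℝ) (𝓡 d) (fun t : ℝ => hU.scale t u) s
      ((1 : ℝ →L[ℝ] ℝ).smulRight (hU.radial (d := d) (hU.scale s u))) := by
  have h1 : HasMFDerivAt 𝓘(ℝ, ℝ) 𝓘(ℝ, ℝ) (fun t : ℝ => t - s) s (1 : ℝ →L[ℝ] ℝ) :=
    ((hasFDerivAt_id s).sub_const s).hasMFDerivAt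
  have h2 := hU.hasMFDerivAt_scale_zero (hU.scale s u)
  rw [← sub_self s] at h2
  have h3 := HasMFDerivAt.comp (f := fun t : ℝ => t - s) s h2 h1
  have h4 : (fun t : ℝ => hU.scale t (hU.scale s u)) ∘ (fun t : ℝ => t - s) =
      fun t : ℝ => hU.scale t u := by
    funext t
    rw [Function.comp_apply, ← hU.scale_add, sub_add_cancel]
  rw [h4] at h3
  exact h3

theorem IsConicSubbundle.differential_pull_radial (hU : IsConicSubbundle (d := d) U) {h : M → ℝ}
    (hh : IsScalarField (𝓡 n) h) (u : U) :
    differential (𝓡 d) (pull U h) u (hU.radial u) = 0 := by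
  -- The base point is the value of the curve at 0, which equals `u` only after rewriting by
  -- `scale_zero`.
  have h1 : MDifferentiableAt (𝓡 d) 𝓘(ℝ, ℝ) (pull U h) (hU.scale 0 u) :=
    (hU.contMDiff_pull hh).contMDiffAt.mdifferentiableAt (by simp)
  have h2 := h1.hasMFDerivAt.comp (0 : ℝ) (hU.hasMFDerivAt_scale_zero u)
  have h3 : HasMFDerivAt 𝓘(ℝ, ℝ) 𝓘(ℝ, ℝ) (pull U h ∘ fun t : ℝ => hU.scale t u) 0
      (0 : ℝ →L[ℝ] ℝ) := hasMFDerivAt_const (pull U h u) (0 : ℝ)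
  have h4 := DFunLike.congr_fun (hasMFDerivAt_unique h2 h3) (1 : ℝ)
  rw [hU.scale_zero] at h4
  have h5 : (1 : ℝ →L[ℝ] ℝ).smulRight (hU.radial (d := d) u) (1 : ℝ) = hU.radial (d := d) u :=
    one_smul ℝ _
  exact (congrArg (mfderiv (𝓡 d) 𝓘(ℝ, ℝ) (pull U h) u) h5).symm.trans h4

theorem IsConicSubbundle.differential_lift_radial (hU : IsConicSubbundle (d := d) U) {h : M → ℝ}
    (hh : IsScalarField (𝓡 n) h) (u : U) :
    differential (𝓡 d) (lift U h) u (hU.radial u) = lift U h u := by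
  have h1 : MDifferentiableAt (𝓡 d) 𝓘(ℝ, ℝ) (lift U h) (hU.scale 0 u) :=
    (hU.contMDiff_lift hh).contMDiffAt.mdifferentiableAt (by simp)
  have h2 := h1.hasMFDerivAt.comp (0 : ℝ) (hU.hasMFDerivAt_scale_zero u)
  have h3 : HasMFDerivAt 𝓘(ℝ, ℝ) 𝓘(ℝ, ℝ) (lift U h ∘ fun t : ℝ => hU.scale t u) 0
      ((1 : ℝ →L[ℝ] ℝ).smulRight (lift U h u)) := by
    have h6 : (lift U h ∘ fun t : ℝ => hU.scale t u) = fun t => Real.exp t * lift U h u :=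
      funext fun t => lift_scale _ h t u
    rw [h6]
    have h7 := (Real.hasDerivAt_exp 0).mul_const (lift U h u)
    rw [Real.exp_zero, one_mul] at h7
    exact h7.hasFDerivAt.hasMFDerivAt
  have h4 := DFunLike.congr_fun (hasMFDerivAt_unique h2 h3) (1 : ℝ)
  rw [hU.scale_zero] at h4
  have h5 : (1 : ℝ →L[ℝ] ℝ).smulRight (hU.radial (d := d) u) (1 : ℝ) = hU.radial (d := d) u :=
    one_smul ℝ _
  refine (congrArg (mfderiv (𝓡 d) 𝓘(ℝ, ℝ) (lift U h) u) h5).symm.trans (h4.trans ?_)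
  exact one_smul ℝ (lift U h u)

theorem IsConicSubbundle.mdifferentiableAt_scale (hU : IsConicSubbundle (d := d) U) (s : ℝ)
    (u : U) : MDifferentiableAt (𝓡 d) (𝓡 d) (hU.scale s) u :=
  ContMDiffAt.mdifferentiableAt (n := ∞)
    (hU.contMDiff_scale.comp (contMDiff_const (c := s).prodMk contMDiff_id)).contMDiffAt (by simp)

/-- Dilations rescale a Vlasov field. -/
theorem IsVlasovField.mfderiv_scale [T2Space M] (hU : IsConicSubbundle (d := d) U)
    {W : (u : U) → TangentSpace (𝓡 d) u} (hW : IsVlasovField hU.toIsConic W) (s : ℝ) (u : U) :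
    mfderiv (𝓡 d) (𝓡 d) (hU.scale s) u (W u) = Real.exp (-s) • W (hU.scale s u) := by
  have hs := (hU.mdifferentiableAt_scale s u).hasMFDerivAt
  have he : Real.exp (-s) * Real.exp s = 1 := by rw [← Real.exp_add]; simp
  -- On `π^* h` both sides give `ḣ(u)`, the right one as `e^{-s} · e^s ḣ(u)`. On `ḣ` the left side
  -- is `e^s W⟨ḣ⟩(u)` and the right is `e^{-s} · e^{2s} W⟨ḣ⟩(u)`.
  refine hU.eq_of_differential_eq _ _ (fun h hh => ?_) fun h hh => ?_
  · have h1 := ((hU.contMDiff_pull hh).contMDiffAt.mdifferentiableAt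
      (by simp)).hasMFDerivAt.comp u hs
    have h2 : mfderiv (𝓡 d) 𝓘(ℝ, ℝ) (pull U h) u = _ := h1.mfderiv
    have h3 := hW.horizontal h hh u
    have h4 := hW.horizontal h hh (hU.scale s u)
    rw [map_smul]
    refine (DFunLike.congr_fun h2 (W u)).symm.trans (h3.trans ?_)
    change _ = Real.exp (-s) * act (𝓡 d) W (pull U h) (hU.scale s u)
    rw [h4, lift_scale, ← mul_assoc, he, one_mul]
  · have h1 := ((hU.contMDiff_lift hh).contMDiffAt.mdifferentiableAt
      (by simp)).hasMFDerivAt.comp u hs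
    have h5 : lift U h ∘ hU.scale s = fun v => Real.exp s * lift U h v :=
      funext fun v => lift_scale _ h s v
    have h6 : HasMFDerivAt (𝓡 d) 𝓘(ℝ, ℝ) (lift U h ∘ hU.scale s) u
        (Real.exp s • mfderiv (𝓡 d) 𝓘(ℝ, ℝ) (lift U h) u : EuclideanSpace ℝ (Fin d) →L[ℝ] ℝ) := by
      rw [h5]
      exact ((hU.contMDiff_lift hh).contMDiffAt.mdifferentiableAt
        (by simp)).hasMFDerivAt.const_smul (Real.exp s)
    have h2 := DFunLike.congr_fun (hasMFDerivAt_unique h1 h6) (W u)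
    have h4 := hW.quadratic h hh u (Real.exp s) (Real.exp_pos s)
    rw [map_smul]
    refine h2.trans ?_
    change Real.exp s * act (𝓡 d) W (lift U h) u =
      Real.exp (-s) * act (𝓡 d) W (lift U h) (hU.dilate (Real.exp s) _ u)
    rw [h4]
    linear_combination (-Real.exp s * act (𝓡 d) W (lift U h) u) * he

/-- Linear forms dual to the radial field and a Vlasov field at a point. -/
theorem IsVlasovField.exists_dual [T2Space M] (hU : IsConicSubbundle (d := d) U)
    {W : (u : U) → TangentSpace (𝓡 d) u} (hW : IsVlasovField hU.toIsConic W) (u : U) :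
    ∃ f g : Module.Dual ℝ (TangentSpace (𝓡 d) u), f (hU.radial u) = 1 ∧ f (W u) = 0 ∧
      g (hU.radial u) = 0 ∧ g (W u) = 1 := by
  obtain ⟨h, hh, h1⟩ := exists_scalarLift_eq_one (u : TangentBundle (𝓡 n) M)
    (hU.snd_ne_zero u u.2)
  have hl : lift U h u = 1 := h1
  have hgW : differential (𝓡 d) (pull U h) u (W u) = 1 := (hW.horizontal h hh u).trans hl
  have hgR := hU.differential_pull_radial hh u
  -- `d(π^* h)` kills `R` and is 1 on `W`; subtracting the right multiple of it from `dḣ` kills `W`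
  -- without changing the value 1 on `R`.
  refine ⟨differential (𝓡 d) (lift U h) u -
    differential (𝓡 d) (lift U h) u (W u) • differential (𝓡 d) (pull U h) u,
    differential (𝓡 d) (pull U h) u, ?_, ?_, hgR, hgW⟩
  · rw [LinearMap.sub_apply, LinearMap.smul_apply, hgR, hU.differential_lift_radial hh, hl]
    simp
  · rw [LinearMap.sub_apply, LinearMap.smul_apply, hgW]
    simp

end VlasovField

/-! ### The surface swept out by an integral curve -/

section Surface

variable {n : ℕ} {M : Type*} [TopologicalSpace M] [ChartedSpace (EuclideanSpace ℝ (Fin n)) M]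
  [IsManifold (𝓡 n) ∞ M] {U : Set (TangentBundle (𝓡 n) M)} {d : ℕ}
  [ChartedSpace (EuclideanSpace ℝ (Fin d)) U] [IsManifold (𝓡 d) ∞ U]

/-- The surface swept out by the dilations of an integral curve of a Vlasov field. -/
noncomputable def IsConic.sweep (hU : IsConic U) (γ : ℝ → U) (x : EuclideanSpace ℝ (Fin 2)) : U :=
  hU.scale (x 0) (γ (x 1))

theorem IsConicSubbundle.contMDiffOn_sweep (hU : IsConicSubbundle (d := d) U) {γ : ℝ → U}
    {J : Set ℝ} (hγ : ContMDiffOn 𝓘(ℝ, ℝ) (𝓡 d) ∞ γ J) :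
    ContMDiffOn (𝓡 2) (𝓡 d) ∞ (hU.sweep γ) {x | x 1 ∈ J} := by
  have hc : ∀ i : Fin 2, ContMDiff (𝓡 2) 𝓘(ℝ, ℝ) ∞ (fun x : EuclideanSpace ℝ (Fin 2) => x i) :=
    fun i => (EuclideanSpace.proj i : EuclideanSpace ℝ (Fin 2) →L[ℝ] ℝ).contDiff.contMDiff
  exact hU.contMDiff_scale.comp_contMDiffOn ((hc 0).contMDiffOn.prodMk
    (hγ.comp (hc 1).contMDiffOn fun x hx => hx))

/-- The first variable follows the flow of `R`; the second moves with velocity `W` along `γ`, and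
the dilation carries this to `e^{-s} W`. -/
theorem IsVlasovField.mfderiv_sweep [T2Space M] (hU : IsConicSubbundle (d := d) U)
    {W : (u : U) → TangentSpace (𝓡 d) u} (hW : IsVlasovField hU.toIsConic W) {γ : ℝ → U}
    {x : EuclideanSpace ℝ (Fin 2)} (hγ : HasMFDerivAt 𝓘(ℝ, ℝ) (𝓡 d) γ (x 1)
      ((1 : ℝ →L[ℝ] ℝ).smulRight (W (γ (x 1))))) (w : EuclideanSpace ℝ (Fin 2)) :
    mfderiv (𝓡 2) (𝓡 d) (hU.sweep γ) x w = w 0 • hU.radial (d := d) (hU.sweep γ x) +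
      (w 1 * Real.exp (-x 0)) • W (hU.sweep γ x) := by
  have hc : ∀ i : Fin 2, HasMFDerivAt (𝓡 2) 𝓘(ℝ, ℝ)
      (fun x : EuclideanSpace ℝ (Fin 2) => x i) x
      (EuclideanSpace.proj i : EuclideanSpace ℝ (Fin 2) →L[ℝ] ℝ) :=
    fun i => (EuclideanSpace.proj i : EuclideanSpace ℝ (Fin 2) →L[ℝ] ℝ).hasFDerivAt.hasMFDerivAt
  have hs : MDifferentiableAt (𝓘(ℝ, ℝ).prod (𝓡 d)) (𝓡 d)
      (fun y : ℝ × U => hU.scale y.1 y.2) (x 0, γ (x 1)) :=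
    hU.contMDiff_scale.contMDiffAt.mdifferentiableAt (by simp)
  have h1 : HasMFDerivAt (𝓡 2) (𝓡 d) (hU.sweep γ) x _ :=
    HasMFDerivAt.comp (f := fun x : EuclideanSpace ℝ (Fin 2) => (x 0, γ (x 1))) x hs.hasMFDerivAt
      ((hc 0).prodMk (HasMFDerivAt.comp (f := fun x : EuclideanSpace ℝ (Fin 2) => x 1) x hγ (hc 1)))
  rw [h1.mfderiv]
  refine (mfderiv_prod_eq_add_apply hs).trans ?_
  congr 1
  · exact DFunLike.congr_fun (hU.hasMFDerivAt_scale (γ (x 1)) (x 0)).mfderiv (w 0)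
  · refine (map_smul (mfderiv (𝓡 d) (𝓡 d) (hU.scale (x 0)) (γ (x 1))) (w 1)
      (W (γ (x 1)))).trans ?_
    rw [hW.mfderiv_scale hU, smul_smul]
    rfl

end Surface

end Vlasov

theorem mainTheorem5 {n d : ℕ} {M : Type*} [TopologicalSpace M] [T2Space M]
    [SecondCountableTopology M] [ChartedSpace (EuclideanSpace ℝ (Fin n)) M]
    [IsManifold (𝓡 n) ∞ M] (U : Set (TangentBundle (𝓡 n) M))
    [ChartedSpace (EuclideanSpace ℝ (Fin d)) U] [IsManifold (𝓡 d) ∞ U]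
    (hU : Vlasov.IsConicSubbundle (d := d) U)
    (Ψ : (u : U) → ⋀[ℝ]^2 (TangentSpace (𝓡 d) u))
    (hΨ : Vlasov.IsVlasovBivector hU.toIsConic Ψ) (u : U) :
    ∃ K : Set U, u ∈ K ∧
      ∃ (_ : ChartedSpace (EuclideanSpace ℝ (Fin 2)) K) (_ : IsManifold (𝓡 2) ∞ K),
        IsSmoothEmbedding (𝓡 2) (𝓡 d) ∞ (Subtype.val : K → U) ∧
        Vlasov.IsTangentBivector (𝓡 d) (𝓡 2) (Subtype.val : K → U) Ψ := by
  obtain ⟨hΨh, W, hW, hΨW⟩ := hΨ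
  obtain ⟨γ, J, hJ, h0, hγ0, hγs, hγ⟩ := Vlasov.exists_contMDiffOn_integralCurve hW.isVectorField u
  let S : Set (EuclideanSpace ℝ (Fin 2)) := {x | x 1 ∈ J}
  have hS : IsOpen S := hJ.preimage (by fun_prop)
  have h0S : (0 : EuclideanSpace ℝ (Fin 2)) ∈ S := h0
  have hd : ∀ x ∈ S, ∀ w : EuclideanSpace ℝ (Fin 2),
      mfderiv (𝓡 2) (𝓡 d) (hU.sweep γ) x w = w 0 • hU.radial (d := d) (hU.sweep γ x) +
        (w 1 * Real.exp (-x 0)) • W (hU.sweep γ x) :=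
    fun x hx w => hW.mfderiv_sweep hU (hγ _ hx) w
  have hinj : Function.Injective (mfderiv (𝓡 2) (𝓡 d) (hU.sweep γ) 0) := by
    refine (injective_iff_map_eq_zero _).2 fun (w : EuclideanSpace ℝ (Fin 2)) hw => ?_
    obtain ⟨f, g, hfR, hfW, hgR, hgW⟩ := hW.exists_dual hU (hU.sweep γ 0)
    have hw' := (hd 0 h0S w).symm.trans hw
    have h1 := congrArg f hw'
    have h2 := congrArg g hw'
    rw [map_add, map_smul, map_smul, hfR, hfW, map_zero] at h1
    rw [map_add, map_smul, map_smul, hgR, hgW, map_zero] at h2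
    have h3 : w 0 = 0 := by simpa using h1
    have h4 : w 1 = 0 := by simpa using h2
    refine PiLp.ext fun i => ?_
    fin_cases i
    · exact h3
    · exact h4
  have hspan : ∀ X : (p : U) → TangentSpace (𝓡 d) p,
      (∀ p, ∃ a b : ℝ, X p = a • hU.radial (d := d) p + b • W p) →
      ∀ x ∈ S, ∃ w, mfderiv (𝓡 2) (𝓡 d) (hU.sweep γ) x w = X (hU.sweep γ x) := by
    intro X hX x hx
    obtain ⟨a, b, hab⟩ := hX (hU.sweep γ x)
    -- The factor `exp (x 0)` compensates the `exp (-x 0)` in the differential of the sweep.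
    refine ⟨(!₂[a, b * Real.exp (x 0)] : EuclideanSpace ℝ (Fin 2)), ?_⟩
    refine (hd x hx _).trans ?_
    rw [hab]
    have he : b * Real.exp (x 0) * Real.exp (-x 0) = b := by
      rw [mul_assoc, ← Real.exp_add]
      simp
    simp [he]
  obtain ⟨K, huK, hK₁, hK₂, hemb, htan⟩ :=
    Vlasov.exists_embedded_image hS (hU.contMDiffOn_sweep hγs) h0S hinj
  have hF0 : hU.sweep γ 0 = u := by
    change hU.scale 0 (γ 0) = u
    rw [hU.scale_zero, hγ0]
  refine ⟨K, hF0 ▸ huK, hK₁, hK₂, hemb, hΨh.simple, ?_⟩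
  rintro X Y ⟨hX, hY, hXY⟩
  -- Pointwise coefficients suffice: `htan` supplies the smoothness of the induced field.
  have hcomb : ∀ p, ∃ f g : Module.Dual ℝ (TangentSpace (𝓡 d) p),
      X p = f (X p) • hU.radial (d := d) p + g (X p) • W p ∧
      Y p = f (Y p) • hU.radial (d := d) p + g (Y p) • W p := by
    intro p
    obtain ⟨f, g, hfR, hfW, hgR, hgW⟩ := hW.exists_dual hU p
    exact ⟨f, g, Vlasov.eq_add_of_ιMulti_eq (congrFun (hΨW.symm.trans hXY) p) f g hfR hfW hgR hgW⟩
  refine ⟨htan X hX (hspan X fun p => ?_), htan Y hY (hspan Y fun p => ?_)⟩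
  · obtain ⟨f, g, h1, -⟩ := hcomb p
    exact ⟨_, _, h1⟩
  · obtain ⟨f, g, -, h2⟩ := hcomb p
    exact ⟨_, _, h2⟩
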